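/- Fix $c\in(0,1)$. For each $n\ge 0$, let $f:\{0,1\}^n\to[0,1]$ be chosen at random according to the uniform measure on $[0,1]^{\{0,1\}^n}$ (that is, the $2^n$ values of $f$ are independent and uniformly distributed on $[0,1]$). Call $f$ $c$-Lipschitz if changing any one coordinate of any $\mathbf{u}\in\{0,1\}^n$ changes the value $f(\mathbf{u})$ by at most $c$. Then, as $n\to\infty$, $$\mathbb{P}\left(f\text{ is }c\text{-Lipschitz}\right)=c^{2^n+o(2^n)}.$$ That is, there is a sequence $(e_n)_{n\ge0}$ of real numbers, depending only on $c$, with $e_n/2^n\to0$ as $n\to\infty$ and $\mathbb{P}(f\text{ is }c\text{-Lipschitz})=c^{2^n+e_n}$ for every $n\ge0$. -/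

import Mathlib

/-- The vertex set `{0,1}^n` of the `n`-dimensional hypercube. -/
abbrev Hypercube (n : ℕ) : Type := Fin n → Bool

/-- `f : {0,1}^n → [0,1]` is `c`-Lipschitz if changing one coordinate of the argument changes
the value of `f` by at most `c`. -/
def IsCubeLipschitz {n : ℕ} (c : ℝ) (f : Hypercube n → unitInterval) : Prop :=
  ∀ (u : Hypercube n) (i : Fin n) (b : Bool), |(f (Function.update u i b) : ℝ) - (f u : ℝ)| ≤ c

/-- The uniform probability measure on `[0,1]^({0,1}^n)`: the product, over the vertices of the
cube, of Lebesgue measure on `[0,1]`. -/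
noncomputable def uniformCubeMeasure (n : ℕ) :
    MeasureTheory.Measure (Hypercube n → unitInterval) :=
  MeasureTheory.Measure.pi fun _ => (MeasureTheory.volume : MeasureTheory.Measure unitInterval)

open MeasureTheory Finset Filter Topology
open scoped ENNReal

/-! ### Marginal integrals and Finner's inequality. -/

section Marginal

variable {δ κ : Type*} [DecidableEq δ] {X : δ → Type*} [∀ i, MeasurableSpace (X i)]
  {μ : ∀ i, Measure (X i)}

/-! For the lower bound, any function with all values in `[0,c]` is Lipschitz. For the upper bound,
split the cube by parity. Given the even values, the odd values are independently constrained, and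
the constraint at `b` has probability `T`, the measure of the common `c`-neighbourhood of the values
at the `n` neighbours of `b`. Each even vertex has `n` odd neighbours, so Finner's inequality with
weights `1/n` (`lmarginal_prod_rpow_le`) bounds the integral of the product by `(∫ T^n)^(1/n)` per
odd vertex.

Here `∫ T^n` is the Lipschitz probability on `K_{n,n}`. If one side has values spanning width `w`,
the other side is confined to width at most `2c - w`, and `w(2c - w) ≤ c^2`. Discretizing the
extreme values on a grid of mesh `1/M` costs a factor `(M+1)^2` and replaces `c` by `c + 1/M`
(`lintegral_volume_common_nhd_pow_le`). With `M = n` these losses vanish after taking `n`-th roots.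
-/

theorem lmarginal_update_of_dependsOn {f : (∀ i, X i) → ℝ≥0∞} {N : Set δ} (hf : DependsOn f N)
    (s : Finset δ) {a : δ} (ha : a ∉ N) (x : ∀ i, X i) (y : X a) :
    (∫⋯∫⁻_s, f ∂μ) (Function.update x a y) = (∫⋯∫⁻_s, f ∂μ) x := by
  unfold lmarginal
  refine lintegral_congr fun z => hf fun i hi => ?_
  have : i ≠ a := fun h => ha (h ▸ hi)
  simp [Function.updateFinset, Function.update_of_ne this]

variable [∀ i, IsProbabilityMeasure (μ i)]

/-- Integrating out variables on which a function does not depend leaves it unchanged. -/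
theorem lmarginal_eq_self_of_dependsOn {f : (∀ i, X i) → ℝ≥0∞} {N : Set δ} (hf : DependsOn f N)
    {s : Finset δ} (hs : ∀ a ∈ s, a ∉ N) : ∫⋯∫⁻_s, f ∂μ = f := by
  ext x
  have h : ∀ y, f (Function.updateFinset x s y) = f x := fun y =>
    hf fun i hi => by
      have : i ∉ s := fun his => hs i his hi
      simp [Function.updateFinset, this]
  simp [lmarginal, h]

/-- Only the variables on which a function depends have to be integrated out. -/
theorem lmarginal_eq_of_dependsOn {f : (∀ i, X i) → ℝ≥0∞} (hfm : Measurable f) {N : Set δ}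
    (hf : DependsOn f N) {s t : Finset δ} (hts : t ⊆ s) (hs : ∀ a ∈ s, a ∉ t → a ∉ N) :
    ∫⋯∫⁻_s, f ∂μ = ∫⋯∫⁻_t, f ∂μ := by
  rw [← union_sdiff_of_subset hts, lmarginal_union μ f hfm disjoint_sdiff,
    lmarginal_eq_self_of_dependsOn hf]
  intro a ha
  rw [Finset.mem_sdiff] at ha
  exact hs a ha.1 ha.2

/-- **Finner's inequality**: if the weights of the functions depending on any given variable of `s`
add up to one, then the integral over `s` of a weighted product is at most the weighted product of
the integrals. -/
theorem lmarginal_prod_rpow_le (s : Finset δ) (B : Finset κ) {N : κ → Set δ}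
    [∀ a, DecidablePred fun b => a ∈ N b]
    {F : κ → (∀ i, X i) → ℝ≥0∞} (hFm : ∀ b, Measurable (F b)) (hF : ∀ b, DependsOn (F b) (N b))
    {p : κ → ℝ} (hp0 : ∀ b, 0 ≤ p b) (hp : ∀ a ∈ s, ∑ b ∈ B with a ∈ N b, p b = 1)
    (x : ∀ i, X i) :
    (∫⋯∫⁻_s, (fun x => ∏ b ∈ B, F b x ^ p b) ∂μ) x ≤ ∏ b ∈ B, (∫⋯∫⁻_s, F b ∂μ) x ^ p b := by
  have hm : Measurable fun x => ∏ b ∈ B, F b x ^ p b :=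
    Finset.measurable_fun_prod _ fun b _ => (hFm b).pow_const _
  induction s using Finset.induction generalizing x with
  | empty => simp
  | insert a s ha ih =>
    rw [lmarginal_insert _ hm ha]
    -- Factors not involving `a` are constant in `y` and come out of the integral; Hölder handles
    -- the rest, whose weights sum to one.
    have hstep : ∀ y, (∫⋯∫⁻_s, (fun x => ∏ b ∈ B, F b x ^ p b) ∂μ) (Function.update x a y) ≤
        (∏ b ∈ B with a ∉ N b, (∫⋯∫⁻_(insert a s), F b ∂μ) x ^ p b) *
          ∏ b ∈ B with a ∈ N b, (∫⋯∫⁻_s, F b ∂μ) (Function.update x a y) ^ p b := by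
      intro y
      refine (ih (fun a' ha' => hp a' (mem_insert_of_mem ha')) _).trans_eq ?_
      rw [mul_comm, ← Finset.prod_filter_mul_prod_filter_not B (fun b => a ∈ N b)]
      congr 1
      refine Finset.prod_congr rfl fun b hb => ?_
      have hab : a ∉ N b := (mem_filter.1 hb).2
      rw [lmarginal_update_of_dependsOn (hF b) s hab, lmarginal_eq_of_dependsOn (hFm b) (hF b)
        (subset_insert a s)]
      intro a' ha' has
      rcases mem_insert.1 ha' with rfl | h
      · exact hab
      · exact absurd h has
    have hmeas : ∀ b, Measurable fun y => (∫⋯∫⁻_s, F b ∂μ) (Function.update x a y) := fun b =>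
      (hFm b).lmarginal μ |>.comp (measurable_update x)
    calc ∫⁻ y, (∫⋯∫⁻_s, (fun x => ∏ b ∈ B, F b x ^ p b) ∂μ) (Function.update x a y) ∂μ a
        ≤ ∫⁻ y, (∏ b ∈ B with a ∉ N b, (∫⋯∫⁻_(insert a s), F b ∂μ) x ^ p b) *
          ∏ b ∈ B with a ∈ N b, (∫⋯∫⁻_s, F b ∂μ) (Function.update x a y) ^ p b ∂μ a :=
          lintegral_mono hstep
      _ = (∏ b ∈ B with a ∉ N b, (∫⋯∫⁻_(insert a s), F b ∂μ) x ^ p b) *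
          ∫⁻ y, ∏ b ∈ B with a ∈ N b, (∫⋯∫⁻_s, F b ∂μ) (Function.update x a y) ^ p b ∂μ a :=
          lintegral_const_mul _
            (Finset.measurable_fun_prod _ fun b _ => (hmeas b).pow_const _)
      _ ≤ (∏ b ∈ B with a ∉ N b, (∫⋯∫⁻_(insert a s), F b ∂μ) x ^ p b) *
          ∏ b ∈ B with a ∈ N b, (∫⁻ y, (∫⋯∫⁻_s, F b ∂μ) (Function.update x a y) ∂μ a) ^ p b := by
          gcongr
          exact ENNReal.lintegral_prod_norm_pow_le _ (fun b _ => (hmeas b).aemeasurable)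
            (hp a (mem_insert_self a s)) fun b _ => hp0 b
      _ = ∏ b ∈ B, (∫⋯∫⁻_(insert a s), F b ∂μ) x ^ p b := by
          rw [mul_comm, ← Finset.prod_filter_mul_prod_filter_not B (fun b => a ∈ N b)]
          congr 1
          refine Finset.prod_congr rfl fun b _ => ?_
          rw [lmarginal_insert _ (hFm b) ha]

end Marginal

/-- The marginal integral of a function of finitely many distinct integrated variables. -/
theorem lmarginal_comp_injective {δ ι Y : Type*} [DecidableEq δ] [Fintype ι] [DecidableEq ι]
    [MeasurableSpace Y] (ν : Measure Y) [IsProbabilityMeasure ν] {e : ι → δ}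
    (he : Function.Injective e) {s : Finset δ} (hs : ∀ i, e i ∈ s) {f : (ι → Y) → ℝ≥0∞}
    (hf : Measurable f) (x : δ → Y) :
    (∫⋯∫⁻_s, (fun x => f (x ∘ e)) ∂fun _ => ν) x = ∫⁻ z, f z ∂Measure.pi fun _ => ν := by
  have hdep : DependsOn (fun x : δ → Y => f (x ∘ e)) (Set.range e) := fun x y h => by
    exact congrArg f (funext fun i => h _ ⟨i, rfl⟩)
  have hm : Measurable fun x : δ → Y => f (x ∘ e) :=
    hf.comp (measurable_pi_lambda _ fun i => measurable_pi_apply _)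
  rw [lmarginal_eq_of_dependsOn hm hdep (t := univ.image e)]
  · have := lmarginal_image (μ := fun _ : δ => ν) he univ hf x
    simp only [lmarginal_univ] at this
    exact this
  · intro a ha
    obtain ⟨i, -, rfl⟩ := mem_image.1 ha
    exact hs i
  · rintro a - ha ⟨i, rfl⟩
    exact ha (mem_image_of_mem _ (mem_univ i))

/-! ### The Lipschitz probability on `K_{n,n}`. -/

theorem volume_unitInterval_le (a b : ℝ) :
    volume {y : unitInterval | a ≤ y ∧ (y : ℝ) ≤ b} ≤ ENNReal.ofReal (b - a) := by
  rw [unitInterval.volume_apply, ← Real.volume_Icc]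
  refine measure_mono ?_
  rintro _ ⟨y, hy, rfl⟩
  exact hy

/-- The common `c`-neighbourhood of finitely many points of `[0,1]` is small compared with the
smallest grid interval containing them. -/
theorem volume_common_nhd_pow_le {n : ℕ} (hn : 0 < n) (c : ℝ) {M : ℕ} (hM : 0 < M)
    (x : Fin n → unitInterval) :
    volume {y : unitInterval | ∀ i, |(y : ℝ) - x i| ≤ c} ^ n ≤
      ∑ q ∈ range (M + 1) ×ˢ range (M + 1),
        {z : Fin n → unitInterval | ∀ i, (q.1 : ℝ) / M ≤ z i ∧ (z i : ℝ) ≤ (q.2 + 1) / M}.indicator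
          1 x * ENNReal.ofReal (2 * c + 2 / M - (q.2 + 1 - q.1) / M) ^ n := by
  have : Nonempty (Fin n) := ⟨⟨0, hn⟩⟩
  have hM' : (0 : ℝ) < M := by exact_mod_cast hM
  obtain ⟨i₀, h₀⟩ := Finite.exists_min fun i => (x i : ℝ)
  obtain ⟨i₁, h₁⟩ := Finite.exists_max fun i => (x i : ℝ)
  have hlow : ∀ i, (⌊(x i : ℝ) * M⌋₊ : ℝ) / M ≤ x i := fun i => by
    rw [div_le_iff₀ hM']
    exact Nat.floor_le (mul_nonneg (x i).2.1 hM'.le)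
  have hupp : ∀ i, (x i : ℝ) ≤ (⌊(x i : ℝ) * M⌋₊ + 1) / M := fun i => by
    rw [le_div_iff₀ hM']
    exact (Nat.lt_floor_add_one _).le
  have hmem : ∀ i, ⌊(x i : ℝ) * M⌋₊ ∈ range (M + 1) := fun i => by
    rw [mem_range, Nat.lt_succ_iff]
    exact Nat.floor_le_of_le (mul_le_of_le_one_left hM'.le (x i).2.2)
  -- The single term given by the grid cells of the minimum and the maximum suffices; index `M`
  -- occurs when a value is `1`.
  refine le_trans ?_ (Finset.single_le_sum (fun _ _ => zero_le)
    (mem_product.2 ⟨hmem i₀, hmem i₁⟩ : (⌊(x i₀ : ℝ) * M⌋₊, ⌊(x i₁ : ℝ) * M⌋₊) ∈ _))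
  rw [Set.indicator_of_mem (fun i => ⟨(hlow i₀).trans (h₀ i), (h₁ i).trans (hupp i₁)⟩),
    Pi.one_apply, one_mul]
  gcongr
  calc volume {y : unitInterval | ∀ i, |(y : ℝ) - x i| ≤ c}
      ≤ volume {y : unitInterval | (x i₁ : ℝ) - c ≤ y ∧ (y : ℝ) ≤ x i₀ + c} :=
        measure_mono fun y hy => by
          have h0 := abs_le.1 (hy i₀)
          have h1 := abs_le.1 (hy i₁)
          exact ⟨by linarith, by linarith⟩
    _ ≤ ENNReal.ofReal (x i₀ + c - (x i₁ - c)) := volume_unitInterval_le _ _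
    _ ≤ _ := by
        refine ENNReal.ofReal_le_ofReal ?_
        have h0 := hupp i₀
        have h1 := hlow i₁
        have : (2 : ℝ) / M - (⌊(x i₁ : ℝ) * M⌋₊ + 1 - ⌊(x i₀ : ℝ) * M⌋₊) / M =
          (⌊(x i₀ : ℝ) * M⌋₊ + 1) / M - ⌊(x i₁ : ℝ) * M⌋₊ / M := by ring
        linarith

theorem measurableSet_forall_mem_grid {n : ℕ} (a b : ℝ) :
    MeasurableSet {z : Fin n → unitInterval | ∀ i, a ≤ z i ∧ (z i : ℝ) ≤ b} := by
  have : {z : Fin n → unitInterval | ∀ i, a ≤ z i ∧ (z i : ℝ) ≤ b} =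
      Set.univ.pi fun _ => Subtype.val ⁻¹' Set.Icc a b := by
    ext z
    simp
  rw [this]
  exact MeasurableSet.univ_pi fun _ => measurable_subtype_coe measurableSet_Icc

/-- The probability that a random function on the vertices of `K_{n,n}` is `c`-Lipschitz. -/
theorem lintegral_volume_common_nhd_pow_le {n : ℕ} (hn : 0 < n) {c : ℝ} (hc : 0 ≤ c) {M : ℕ}
    (hM : 0 < M) :
    ∫⁻ x : Fin n → unitInterval, volume {y : unitInterval | ∀ i, |(y : ℝ) - x i| ≤ c} ^ n
      ∂Measure.pi (fun _ => volume) ≤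
      ENNReal.ofReal ((M + 1) ^ 2 * (c + 1 / M) ^ (2 * n)) := by
  have hM' : (0 : ℝ) < M := by exact_mod_cast hM
  refine (lintegral_mono (volume_common_nhd_pow_le hn c hM)).trans ?_
  rw [lintegral_finsetSum _ fun q _ =>
    (measurable_one.indicator (measurableSet_forall_mem_grid _ _)).mul_const _]
  have hterm : ∀ q ∈ range (M + 1) ×ˢ range (M + 1),
      ∫⁻ x : Fin n → unitInterval,
        {z : Fin n → unitInterval | ∀ i, (q.1 : ℝ) / M ≤ z i ∧ (z i : ℝ) ≤ (q.2 + 1) / M}.indicator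
          1 x * ENNReal.ofReal (2 * c + 2 / M - (q.2 + 1 - q.1) / M) ^ n
          ∂Measure.pi (fun _ => volume) ≤ ENNReal.ofReal ((c + 1 / M) ^ (2 * n)) := by
    intro q _
    rw [lintegral_mul_const _ (measurable_one.indicator (measurableSet_forall_mem_grid _ _)),
      lintegral_indicator_one (measurableSet_forall_mem_grid _ _)]
    have hbox : Measure.pi (fun _ : Fin n => (volume : Measure unitInterval))
        {z | ∀ i, (q.1 : ℝ) / M ≤ z i ∧ (z i : ℝ) ≤ (q.2 + 1) / M} ≤
        ENNReal.ofReal ((q.2 + 1 - q.1) / M) ^ n := by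
      have : {z : Fin n → unitInterval | ∀ i, (q.1 : ℝ) / M ≤ z i ∧ (z i : ℝ) ≤ (q.2 + 1) / M} =
          Set.univ.pi fun _ => {y : unitInterval | (q.1 : ℝ) / M ≤ y ∧ (y : ℝ) ≤ (q.2 + 1) / M} := by
        ext z
        simp
      rw [this, Measure.pi_pi, prod_const, card_univ, Fintype.card_fin, sub_div]
      gcongr
      exact volume_unitInterval_le _ _
    refine (mul_le_mul_left hbox _).trans ?_
    rw [← mul_pow, pow_mul, ENNReal.ofReal_pow (by positivity)]
    gcongr
    -- With `w` the grid width and `d = c + 1/M`, this is `w(2d - w) ≤ d^2`; pairs with `w ≤ 0`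
    -- contribute nothing.
    rcases le_total ((q.2 + 1 - q.1 : ℝ) / M) 0 with h | h
    · rw [ENNReal.ofReal_of_nonpos h, zero_mul]
      exact zero_le
    · rw [← ENNReal.ofReal_mul h]
      refine ENNReal.ofReal_le_ofReal ?_
      have : (2 : ℝ) / M = 2 * (1 / M) := by ring
      rw [this]
      nlinarith [sq_nonneg (c + 1 / M - (q.2 + 1 - q.1 : ℝ) / M)]
  refine (Finset.sum_le_sum hterm).trans_eq ?_
  rw [sum_const, card_product, card_range, nsmul_eq_mul, ENNReal.ofReal_mul (by positivity),
    ← sq]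
  congr 1
  rw [ENNReal.ofReal_pow (by positivity)]
  norm_cast

/-! ### The bipartite structure of the cube and the two probability bounds. -/

section Cube

variable {n : ℕ}

/-- The neighbour of a vertex of the hypercube along a given direction. -/
def cubeFlip (u : Hypercube n) (i : Fin n) : Hypercube n := Function.update u i (!u i)

theorem cubeFlip_cubeFlip (u : Hypercube n) (i : Fin n) : cubeFlip (cubeFlip u i) i = u := by
  simp [cubeFlip]

theorem cubeFlip_injective (u : Hypercube n) : Function.Injective (cubeFlip u) := by
  intro i j h
  by_contra hij
  have := congrFun h i
  simp [cubeFlip, Function.update_of_ne hij] at this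

/-- The parity of the number of ones of a vertex of the hypercube. -/
def cubeParity (u : Hypercube n) : ZMod 2 := ∑ i, if u i then 1 else 0

theorem cubeParity_cubeFlip (u : Hypercube n) (i : Fin n) :
    cubeParity (cubeFlip u i) = cubeParity u + 1 := by
  unfold cubeParity cubeFlip
  rw [← Finset.add_sum_erase _ _ (mem_univ i), ← Finset.add_sum_erase univ
    (fun j => if u j = true then (1 : ZMod 2) else 0) (mem_univ i)]
  rw [Finset.sum_congr rfl (g := fun j => if u j = true then (1 : ZMod 2) else 0)
    fun j hj => by rw [Function.update_of_ne (ne_of_mem_erase hj)]]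
  rw [Function.update_self]
  rw [add_right_comm]
  congr 1
  cases u i
  · simp
  · simp
    decide

/-- The vertices of the hypercube of a given parity. -/
def cubeLayer (n : ℕ) (z : ZMod 2) : Finset (Hypercube n) := {u | cubeParity u = z}

theorem mem_cubeLayer {z : ZMod 2} {u : Hypercube n} : u ∈ cubeLayer n z ↔ cubeParity u = z := by
  simp [cubeLayer]

theorem cubeFlip_mem_cubeLayer_zero {u : Hypercube n} {i : Fin n} :
    cubeFlip u i ∈ cubeLayer n 0 ↔ u ∈ cubeLayer n 1 := by
  rw [mem_cubeLayer, mem_cubeLayer, cubeParity_cubeFlip]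
  generalize cubeParity u = z
  revert z
  decide

theorem cubeFlip_mem_cubeLayer_one {u : Hypercube n} {i : Fin n} :
    cubeFlip u i ∈ cubeLayer n 1 ↔ u ∈ cubeLayer n 0 := by
  rw [← cubeFlip_mem_cubeLayer_zero (i := i), cubeFlip_cubeFlip]

theorem disjoint_cubeLayer : Disjoint (cubeLayer n 0) (cubeLayer n 1) := by
  rw [Finset.disjoint_left]
  intro u h0 h1
  rw [mem_cubeLayer] at h0 h1
  simp [h0] at h1

theorem cubeLayer_union : cubeLayer n 0 ∪ cubeLayer n 1 = univ := by
  ext u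
  simp only [mem_union, mem_cubeLayer, mem_univ, iff_true]
  generalize cubeParity u = z
  revert z
  decide

theorem two_mul_card_cubeLayer_one (hn : 0 < n) : 2 * #(cubeLayer n 1) = 2 ^ n := by
  have hcard : #(cubeLayer n 0) = #(cubeLayer n 1) :=
    Finset.card_bij' (fun u _ => cubeFlip u ⟨0, hn⟩) (fun u _ => cubeFlip u ⟨0, hn⟩)
      (fun _ hu => cubeFlip_mem_cubeLayer_one.2 hu) (fun _ hu => cubeFlip_mem_cubeLayer_zero.2 hu)
      (fun _ _ => cubeFlip_cubeFlip _ _) (fun _ _ => cubeFlip_cubeFlip _ _)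
  have h := Finset.card_union_of_disjoint (disjoint_cubeLayer (n := n))
  rw [cubeLayer_union, card_univ, hcard] at h
  simp only [Fintype.card_fun, Fintype.card_bool, Fintype.card_fin] at h
  omega

/-- The indicator of the event that all edges at the vertex `b` satisfy the Lipschitz condition. -/
noncomputable def starIndicator (c : ℝ) (b : Hypercube n) :
    (Hypercube n → unitInterval) → ℝ≥0∞ :=
  {x | ∀ i, |(x b : ℝ) - x (cubeFlip b i)| ≤ c}.indicator 1

theorem measurable_starIndicator (c : ℝ) (b : Hypercube n) : Measurable (starIndicator c b) := by
  refine measurable_one.indicator ?_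
  rw [Set.ofPred_forall]
  refine MeasurableSet.iInter fun i => measurableSet_le ?_ measurable_const
  fun_prop

theorem dependsOn_starIndicator (c : ℝ) (b : Hypercube n) :
    DependsOn (starIndicator c b) (insert b (Set.range (cubeFlip b))) := by
  intro x y h
  have hb := h b (Set.mem_insert _ _)
  have hi : ∀ i, x (cubeFlip b i) = y (cubeFlip b i) := fun i =>
    h _ (Set.mem_insert_of_mem _ ⟨i, rfl⟩)
  simp [starIndicator, Set.indicator, hb, hi]

theorem measurable_volume_common_nhd (c : ℝ) :
    Measurable fun z : Fin n → unitInterval =>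
      volume {y : unitInterval | ∀ i, |(y : ℝ) - z i| ≤ c} := by
  have hs : MeasurableSet {q : (Fin n → unitInterval) × unitInterval |
      ∀ i, |(q.2 : ℝ) - q.1 i| ≤ c} := by
    rw [Set.ofPred_forall]
    refine MeasurableSet.iInter fun i => measurableSet_le ?_ measurable_const
    fun_prop
  exact measurable_measure_prodMk_left hs

theorem mem_cubeLayer_one_of_mem_star {a b : Hypercube n} (ha : a ∈ cubeLayer n 1)
    (hb : b ∈ cubeLayer n 1) (h : a ∈ insert b (Set.range (cubeFlip b))) : a = b := by
  rcases h with h | ⟨i, rfl⟩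
  · exact h
  · exact absurd ha (Finset.disjoint_left.1 disjoint_cubeLayer (cubeFlip_mem_cubeLayer_zero.2 hb))

/-- The neighbours of `b` are even, so `b` is the only variable of the star that is integrated. -/
theorem lmarginal_starIndicator (c : ℝ) {b : Hypercube n} (hb : b ∈ cubeLayer n 1)
    (x : Hypercube n → unitInterval) :
    (∫⋯∫⁻_(cubeLayer n 1), starIndicator c b ∂fun _ => volume) x =
      volume {y : unitInterval | ∀ i, |(y : ℝ) - (x ∘ cubeFlip b) i| ≤ c} := by
  rw [lmarginal_eq_of_dependsOn (measurable_starIndicator c b) (dependsOn_starIndicator c b)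
    (singleton_subset_iff.2 hb), lmarginal_singleton]
  · have hne : ∀ i, cubeFlip b i ≠ b := fun i h =>
      Finset.disjoint_left.1 disjoint_cubeLayer (cubeFlip_mem_cubeLayer_zero.2 hb) (h ▸ hb)
    rw [← lintegral_indicator_one]
    · refine lintegral_congr fun y => ?_
      simp [starIndicator, Set.indicator, Function.update_of_ne (hne _)]
    · rw [Set.ofPred_forall]
      refine MeasurableSet.iInter fun i => measurableSet_le ?_ measurable_const
      fun_prop
  · intro a ha hab h
    exact hab (mem_singleton.2 (mem_cubeLayer_one_of_mem_star ha hb h))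

/-- The probability of being Lipschitz on the hypercube is bounded by a power of the one on the
complete bipartite graph `K_{n,n}`. -/
theorem uniformCubeMeasure_lipschitz_le (hn : 0 < n) (c : ℝ) :
    uniformCubeMeasure n {f | IsCubeLipschitz c f} ≤
      ((∫⁻ x : Fin n → unitInterval, volume {y : unitInterval | ∀ i, |(y : ℝ) - x i| ≤ c} ^ n
        ∂Measure.pi (fun _ => volume)) ^ (1 / n : ℝ)) ^ #(cubeLayer n 1) := by
  classical
  have hn' : (n : ℝ) ≠ 0 := by exact_mod_cast hn.ne'
  set T : (Fin n → unitInterval) → ℝ≥0∞ := fun z =>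
    volume {y : unitInterval | ∀ i, |(y : ℝ) - z i| ≤ c} with hT
  have hTm : Measurable T := measurable_volume_common_nhd c
  have hle : ∀ f : Hypercube n → unitInterval, IsCubeLipschitz c f →
      ∏ b ∈ cubeLayer n 1, starIndicator c b f = 1 := by
    intro f hf
    refine Finset.prod_eq_one fun b _ => Set.indicator_of_mem (fun i => ?_) _
    rw [abs_sub_comm]
    exact hf b i _
  have hprod : Measurable fun f : Hypercube n → unitInterval =>
      ∏ b ∈ cubeLayer n 1, starIndicator c b f :=
    Finset.measurable_fun_prod _ fun b _ => measurable_starIndicator c b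
  have hodd : ∀ x : Hypercube n → unitInterval,
      (∫⋯∫⁻_(cubeLayer n 1), (fun f => ∏ b ∈ cubeLayer n 1, starIndicator c b f)
        ∂fun _ => volume) x ≤ ∏ b ∈ cubeLayer n 1, (T (x ∘ cubeFlip b) ^ n) ^ (1 / n : ℝ) := by
    intro x
    -- Weights one are allowed because each odd vertex lies in only one odd-centred star: this is
    -- independence.
    have h := lmarginal_prod_rpow_le (μ := fun _ : Hypercube n => (volume : Measure unitInterval))
      (cubeLayer n 1) (cubeLayer n 1) (measurable_starIndicator c) (dependsOn_starIndicator c)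
      (p := fun _ => 1) (fun _ => zero_le_one) (fun a ha => by
        have : {b ∈ cubeLayer n 1 | a ∈ insert b (Set.range (cubeFlip b))} = {a} := by
          ext b
          simp only [mem_filter, mem_singleton]
          refine ⟨fun hb => (mem_cubeLayer_one_of_mem_star ha hb.1 hb.2).symm, ?_⟩
          rintro rfl
          exact ⟨ha, Set.mem_insert _ _⟩
        rw [this, sum_singleton]) x
    simp only [ENNReal.rpow_one] at h
    refine h.trans_eq (Finset.prod_congr rfl fun b hb => ?_)
    rw [lmarginal_starIndicator c hb, ← ENNReal.rpow_natCast, ← ENNReal.rpow_mul,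
      mul_one_div_cancel hn', ENNReal.rpow_one]
  have heven : ∀ x : Hypercube n → unitInterval,
      (∫⋯∫⁻_(cubeLayer n 0), (fun x => ∏ b ∈ cubeLayer n 1,
        (T (x ∘ cubeFlip b) ^ n) ^ (1 / n : ℝ)) ∂fun _ => volume) x ≤
        ∏ b ∈ cubeLayer n 1, (∫⋯∫⁻_(cubeLayer n 0), (fun x => T (x ∘ cubeFlip b) ^ n)
          ∂fun _ => volume) x ^ (1 / n : ℝ) := by
    refine lmarginal_prod_rpow_le (N := fun b => Set.range (cubeFlip b)) _ _ ?_ ?_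
      (fun _ => by positivity) ?_
    · intro b
      have : Measurable fun x : Hypercube n → unitInterval => x ∘ cubeFlip b :=
        measurable_pi_lambda _ fun i => measurable_pi_apply _
      exact (hTm.comp this).pow_const n
    · intro b x y h
      have : x ∘ cubeFlip b = y ∘ cubeFlip b := funext fun i => h _ ⟨i, rfl⟩
      simp only [this]
    -- An even vertex lies in exactly `n` of the neighbourhoods, so the weights `1/n` sum to one.
    · intro a ha
      have : {b ∈ cubeLayer n 1 | a ∈ Set.range (cubeFlip b)} = univ.image (cubeFlip a) := by
        ext b
        simp only [mem_filter, mem_image, mem_univ, true_and, Set.mem_range]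
        constructor
        · rintro ⟨-, i, rfl⟩
          exact ⟨i, cubeFlip_cubeFlip _ _⟩
        · rintro ⟨i, rfl⟩
          exact ⟨cubeFlip_mem_cubeLayer_one.2 ha, i, cubeFlip_cubeFlip _ _⟩
      rw [this, sum_const, card_image_of_injective _ (cubeFlip_injective a), card_univ,
        Fintype.card_fin, nsmul_eq_mul, mul_one_div_cancel hn']
  -- An arbitrary base point: every variable gets integrated out.
  let x₀ : Hypercube n → unitInterval := fun _ => 0
  calc uniformCubeMeasure n {f | IsCubeLipschitz c f}
      ≤ uniformCubeMeasure n {f | 1 ≤ ∏ b ∈ cubeLayer n 1, starIndicator c b f} :=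
        measure_mono fun f hf => (hle f hf).ge
    _ ≤ ∫⁻ f, ∏ b ∈ cubeLayer n 1, starIndicator c b f ∂uniformCubeMeasure n := by
        simpa only [one_mul] using mul_meas_ge_le_lintegral hprod 1
    _ = (∫⋯∫⁻_(cubeLayer n 0), ∫⋯∫⁻_(cubeLayer n 1),
          (fun f => ∏ b ∈ cubeLayer n 1, starIndicator c b f)
          ∂(fun _ => volume) ∂(fun _ => volume)) x₀ := by
        rw [← lmarginal_union _ _ hprod disjoint_cubeLayer, cubeLayer_union, lmarginal_univ]
        rfl
    _ ≤ _ := lmarginal_mono hodd x₀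
    _ ≤ _ := heven x₀
    _ = _ := by
        rw [Finset.prod_congr rfl (g := fun _ =>
          (∫⁻ x, T x ^ n ∂Measure.pi fun _ => volume) ^ (1 / n : ℝ)), prod_const]
        intro b hb
        rw [lmarginal_comp_injective volume (cubeFlip_injective b)
          (fun i => cubeFlip_mem_cubeLayer_zero.2 hb) (hTm.pow_const n)]

theorem pow_le_uniformCubeMeasure_lipschitz {c : ℝ} (h0 : 0 ≤ c) (h1 : c ≤ 1) (n : ℕ) :
    c ^ 2 ^ n ≤ (uniformCubeMeasure n).real {f | IsCubeLipschitz c f} := by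
  have : IsProbabilityMeasure (uniformCubeMeasure n) := by
    unfold uniformCubeMeasure
    infer_instance
  have hbox : (uniformCubeMeasure n).real
      (Set.univ.pi fun _ => Set.Iic (⟨c, h0, h1⟩ : unitInterval)) = c ^ 2 ^ n := by
    rw [measureReal_def, uniformCubeMeasure, Measure.pi_pi]
    simp [ENNReal.toReal_ofReal h0]
  rw [← hbox]
  refine measureReal_mono fun f hf u i b => ?_
  have ha : ∀ v, (f v : ℝ) ≤ c := fun v => hf v (Set.mem_univ _)
  rw [abs_sub_le_iff]
  constructor <;> linarith [ha u, ha (Function.update u i b), (f u).2.1,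
    (f (Function.update u i b)).2.1]

theorem uniformCubeMeasure_real_lipschitz_le (hn : 0 < n) {c : ℝ} (hc : 0 ≤ c) :
    (uniformCubeMeasure n).real {f | IsCubeLipschitz c f} ≤
      (((n : ℝ) + 1) ^ (1 / n : ℝ) * (c + 1 / n)) ^ 2 ^ n := by
  have hn' : (n : ℝ) ≠ 0 := by exact_mod_cast hn.ne'
  refine ENNReal.toReal_le_of_le_ofReal (by positivity) ?_
  refine (uniformCubeMeasure_lipschitz_le hn c).trans ?_
  -- The grid size is `M = n`.
  have h := lintegral_volume_common_nhd_pow_le hn hc hn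
  calc _ ≤ (ENNReal.ofReal (((n : ℝ) + 1) ^ 2 * (c + 1 / n) ^ (2 * n)) ^ (1 / n : ℝ)) ^
        #(cubeLayer n 1) := by gcongr
    _ = ENNReal.ofReal (((((n : ℝ) + 1) ^ (1 / n : ℝ) * (c + 1 / n)) ^ 2) ^ #(cubeLayer n 1)) := by
        rw [ENNReal.ofReal_rpow_of_nonneg (by positivity) (by positivity),
          ENNReal.ofReal_pow (by positivity)]
        congr 2
        rw [Real.mul_rpow (by positivity) (by positivity), mul_pow,
          ← Real.rpow_natCast_mul (by positivity), ← Real.rpow_natCast_mul (by positivity),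
          ← Real.rpow_mul_natCast (by positivity), ← Real.rpow_natCast (c + 1 / n) 2]
        congr 2
        · push_cast
          ring
        · push_cast
          field_simp
    _ = _ := by rw [← pow_mul, two_mul_card_cubeLayer_one hn]

end Cube

/-! ### Passage to the asymptotic form. -/

theorem mainTheorem7 (c : ℝ) (hc : c ∈ Set.Ioo (0 : ℝ) 1) :
    ∃ e : ℕ → ℝ,
      Asymptotics.IsLittleO Filter.atTop e (fun n : ℕ => (2 : ℝ) ^ n) ∧
      ∀ n : ℕ, (uniformCubeMeasure n).real {f | IsCubeLipschitz c f} = c ^ ((2 : ℝ) ^ n + e n) := by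
  obtain ⟨h0, h1⟩ := hc
  have hlogc : Real.log c < 0 := Real.log_neg h0 h1
  set P : ℕ → ℝ := fun n => (uniformCubeMeasure n).real {f | IsCubeLipschitz c f} with hP
  have hlow : ∀ n, c ^ 2 ^ n ≤ P n := pow_le_uniformCubeMeasure_lipschitz h0.le h1.le
  have hpos : ∀ n, 0 < P n := fun n => (by positivity : 0 < c ^ 2 ^ n).trans_le (hlow n)
  have hlim : Tendsto (fun n => Real.log (P n) / 2 ^ n) atTop (𝓝 (Real.log c)) := by
    have hinv : Tendsto (fun n : ℕ => 1 / (n : ℝ)) atTop (𝓝 0) :=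
      tendsto_one_div_atTop_nhds_zero_nat
    have hroot : Tendsto (fun n : ℕ => ((n : ℝ) + 1) ^ (1 / n : ℝ)) atTop (𝓝 1) := by
      -- This is `x^(1/(x - 1)) → 1` along `x = n + 1`.
      refine ((tendsto_rpow_div_mul_add 1 1 (-1) one_ne_zero.symm).comp
        (tendsto_natCast_atTop_atTop.atTop_add (tendsto_const_nhds (x := (1 : ℝ))))).congr
        fun n => ?_
      simp
    have hupper : Tendsto (fun n : ℕ => Real.log (((n : ℝ) + 1) ^ (1 / n : ℝ) * (c + 1 / n))) atTop
        (𝓝 (Real.log c)) := by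
      have := (hroot.mul (hinv.const_add c)).log (by simpa using h0.ne')
      simpa using this
    refine tendsto_of_tendsto_of_tendsto_of_le_of_le' tendsto_const_nhds hupper ?_ ?_
    · refine Eventually.of_forall fun n => ?_
      rw [le_div_iff₀ (by positivity)]
      have := Real.log_le_log (by positivity) (hlow n)
      rw [Real.log_pow] at this
      push_cast at this
      linarith
    · filter_upwards [eventually_gt_atTop 0] with n hn
      rw [div_le_iff₀ (by positivity)]
      have := Real.log_le_log (hpos n) (uniformCubeMeasure_real_lipschitz_le hn h0.le)
      rw [Real.log_pow] at this
      push_cast at this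
      linarith
  refine ⟨fun n => Real.log (P n) / Real.log c - 2 ^ n, ?_, fun n => ?_⟩
  · rw [Asymptotics.isLittleO_iff_tendsto fun n h => absurd h (by positivity)]
    have := (hlim.div_const (Real.log c)).sub_const 1
    rw [div_self hlogc.ne, sub_self] at this
    refine this.congr fun n => ?_
    field_simp
  · rw [add_sub_cancel, Real.rpow_def_of_pos h0, mul_div_cancel₀ _ hlogc.ne, Real.exp_log (hpos n)]
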